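/- **Theorem (Favard spectral representation).** Let $p\ge 1$ and let $T=(T_{i,j})_{i,j\ge 0}$ be a real semi-infinite monic $(p+2)$-diagonal lower Hessenberg matrix: $T_{n,n+1}=1$, $T_{i,j}=0$ if $j>i+1$ or $i>j+p$, and $T_{n+p,n}\neq 0$ for all $n\ge 0$. Assume that $T$ is bounded, $\|T\|_\infty=\sup_i\sum_j|T_{i,j}|<\infty$, and that it has a positive bidiagonal factorization $$T=L_1L_2\cdots L_pU,$$ where, for some numbers $\alpha_1,\alpha_2,\dots>0$, $L_k$ is lower bidiagonal with ones on the diagonal and $(L_k)_{j+1,j}=\alpha_{k+1+j(p+1)}$, and $U$ is upper bidiagonal with ones on the superdiagonal and $U_{j,j}=\alpha_{1+j(p+1)}$, for all $j\ge 0$. Let $B_n$ (type II recursion polynomials) be determined by $B_0=1$ and $TB=xB$, where $B=(B_0,B_1,\dots)^\top$. Let $\nu\in\mathbb R^{p\times p}$ be lower unitriangular, with rows and columns numbered $0,\dots,p-1$ and $1,\dots,p$, and let $A^{(a)}_n$, $a=1,\dots,p$ (type I recursion polynomials) be determined by $A^{(a)}_i=\nu_{i,a}$ for $0\le i\le p-1$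 and $$A^{(a)}_{n-1}+T_{n,n}A^{(a)}_n+\cdots+T_{n+p,n}A^{(a)}_{n+p}=xA^{(a)}_n,\qquad n\ge 0,\quad A^{(a)}_{-1}=0.$$ Let $\mathscr L\in\mathbb R^{p\times p}$ be the matrix whose first column is $e_1=(1,0,\dots,0)^\top$ and whose $k$-th column, for $2\le k\le p$, is $$\frac1{d_k}\,L_1^{[p-1]}\cdots L_{k-1}^{[p-1]}\,e_1,\qquad d_k=\alpha_k\,\alpha_{k+p}\,\alpha_{k+2p}\cdots\alpha_{k+(k-2)p},$$ where $L_m^{[p-1]}$ is the $p\times p$ leading principal submatrix of $L_m$. Assume that $\nu^{-\top}=\mathscr L\,\mathscr C$ for some upper unitriangular matrix $\mathscr C\in\mathbb R^{p\times p}$ with nonnegative entries. Let $\Delta$ be the smallest closed interval containing all real zeros of all the polynomials $B_n$. Then $\Delta$ is compact, $\Delta\subseteq[0,\|T\|_\infty]$, and there are $p$ nondecreasing right-continuous functions $\psi_1,\dots,\psi_p:\mathbb R\to\mathbb R$ whose (positive) Lebesgue–Stieltjes measures $\mathrm d\psi_a$ are supported in $\Delta$, $\mathrm d\psi_a(\mathbb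 R\setminus\Delta)=0$, such that for all $k,l\ge 0$ $$\int_\Delta\bigl(A^{(1)}_k(x)\,\mathrm d\psi_1(x)+\cdots+A^{(p)}_k(x)\,\mathrm d\psi_p(x)\bigr)B_l(x)=\delta_{k,l}.$$ -/

import Mathlib

namespace HessenbergFavard

open Polynomial

/-! Semi-infinite real matrices are functions `Matrix ℕ ℕ ℝ`, rows and columns numbered from `0`. -/

/-- Monic `(p+2)`-diagonal lower Hessenberg matrices: ones on the first superdiagonal, zeros above
it and below the `p`-th subdiagonal, no zero on the `p`-th subdiagonal. -/
structure IsMonicBandedHessenberg (p : ℕ) (T : Matrix ℕ ℕ ℝ) : Prop where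
  superdiag : ∀ n, T n (n + 1) = 1
  above : ∀ i j, i + 1 < j → T i j = 0
  below : ∀ i j, j + p < i → T i j = 0
  lowest : ∀ n, T (n + p) n ≠ 0

/-- The absolute row sum of row `i` of a lower Hessenberg matrix (its entries in the columns
beyond `i + 1` vanish). -/
noncomputable def absRowSum (T : Matrix ℕ ℕ ℝ) (i : ℕ) : ℝ :=
  ∑ j ∈ Finset.range (i + 2), |T i j|

/-- A lower Hessenberg matrix is bounded if its absolute row sums are bounded. -/
def IsBoundedHessenberg (T : Matrix ℕ ℕ ℝ) : Prop :=
  BddAbove (Set.range (absRowSum T))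

/-- The norm `‖T‖_∞` of a bounded lower Hessenberg matrix. -/
noncomputable def infNorm (T : Matrix ℕ ℕ ℝ) : ℝ :=
  ⨆ i, absRowSum T i

/-- The product of semi-infinite matrices. It is used only for row-finite left factors, where
the sum has finitely many nonzero terms. -/
noncomputable def infMul (M N : Matrix ℕ ℕ ℝ) : Matrix ℕ ℕ ℝ :=
  Matrix.of fun i j => ∑ᶠ k, M i k * N k j

/-- The lower bidiagonal factor `L_k`: ones on the diagonal and
`(L_k)_{j+1,j} = α_{k+1+j(p+1)}`. -/
def lowerFactor (p : ℕ) (α : ℕ → ℝ) (k : ℕ) : Matrix ℕ ℕ ℝ :=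
  Matrix.of fun i j =>
    if i = j then 1 else if i = j + 1 then α (k + 1 + j * (p + 1)) else 0

/-- The upper bidiagonal factor `U`: `U_{j,j} = α_{1+j(p+1)}` and ones on the superdiagonal. -/
def upperFactor (p : ℕ) (α : ℕ → ℝ) : Matrix ℕ ℕ ℝ :=
  Matrix.of fun i j =>
    if i = j then α (1 + j * (p + 1)) else if j = i + 1 then 1 else 0

/-- The product `L_1 L_2 ⋯ L_k`. -/
noncomputable def lowerProd (p : ℕ) (α : ℕ → ℝ) : ℕ → Matrix ℕ ℕ ℝ
  | 0 => 1
  | k + 1 => infMul (lowerProd p α k) (lowerFactor p α (k + 1))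

/-- `T = L_1 ⋯ L_p U` is a positive bidiagonal factorization with parameters `α_1, α_2, …`
(the value `α 0` is not used). -/
def IsPositiveBidiagonalFactorization (p : ℕ) (α : ℕ → ℝ) (T : Matrix ℕ ℕ ℝ) : Prop :=
  (∀ i, 1 ≤ i → 0 < α i) ∧ T = infMul (lowerProd p α p) (upperFactor p α)

/-- The recursion polynomials of type II: `B_0 = 1` and `T B = x B`. -/
noncomputable def typeII (T : Matrix ℕ ℕ ℝ) : ℕ → ℝ[X]
  | 0 => 1
  | n + 1 => X * typeII T n - ∑ j : Fin (n + 1), C (T n j) * typeII T j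
  decreasing_by all_goals omega

/-- The recursion polynomials of type I, `typeI p T ν a n = A^{(a+1)}_n`. The first `p` of them
are the entries of column `a` of the initial condition matrix `ν`, and the others are found from
`A_{n-1} + T_{n,n} A_n + ⋯ + T_{n+p,n} A_{n+p} = x A_n`, where `A_{-1} = 0`, solved for
`A_{n+p}`; here `m = n + p`. -/
noncomputable def typeI (p : ℕ) (T : Matrix ℕ ℕ ℝ) (ν : Matrix (Fin p) (Fin p) ℝ) (a : Fin p)
    (m : ℕ) : ℝ[X] :=
  have hp : 0 < p := a.pos
  if h : m < p then C (ν ⟨m, h⟩ a)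
  else
    C (T m (m - p))⁻¹ *
      (X * typeI p T ν a (m - p)
        - (if m - p = 0 then 0 else typeI p T ν a (m - p - 1))
        - ∑ j : Fin p, C (T (m - p + j) (m - p)) * typeI p T ν a (m - p + j))
  termination_by m
  decreasing_by all_goals omega

/-- Lower unitriangular matrices. -/
def IsLowerUnitriangular {p : ℕ} (M : Matrix (Fin p) (Fin p) ℝ) : Prop :=
  (∀ i, M i i = 1) ∧ ∀ i j, i < j → M i j = 0

/-- Upper unitriangular matrices. -/
def IsUpperUnitriangular {p : ℕ} (M : Matrix (Fin p) (Fin p) ℝ) : Prop :=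
  (∀ i, M i i = 1) ∧ ∀ i j, j < i → M i j = 0

/-- The `p × p` leading principal submatrix of `L_k`. -/
def lowerFactorTrunc (p : ℕ) (α : ℕ → ℝ) (k : ℕ) : Matrix (Fin p) (Fin p) ℝ :=
  Matrix.of fun i j => lowerFactor p α k i j

/-- The matrix `𝓛`, whose `k`-th column (`k = c + 1`) is `L_1 ⋯ L_{k-1} e_1 / d_k`, with the
factors truncated to size `p × p` and `d_k = α_k α_{k+p} ⋯ α_{k+(k-2)p}`. -/
noncomputable def scriptL (p : ℕ) (α : ℕ → ℝ) : Matrix (Fin p) (Fin p) ℝ :=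
  Matrix.of fun i c =>
    (∏ m ∈ Finset.range (c : ℕ), α ((c : ℕ) + 1 + m * p))⁻¹ *
      (((List.range (c : ℕ)).map fun m => lowerFactorTrunc p α (m + 1)).prod.mulVec
        fun j : Fin p => if (j : ℕ) = 0 then 1 else 0) i

/-- The interval `Δ`: the smallest closed interval containing all zeros of all the type II
polynomials. -/
def trueInterval (T : Matrix ℕ ℕ ℝ) : Set ℝ :=
  closure (convexHull ℝ {x | ∃ n, (typeII T n).IsRoot x})

end HessenbergFavard

open HessenbergFavard

namespace HessenbergFavard

open Polynomial

/-! Fix `c ≤ p` and write `T = G R U` with `G = L_1 ⋯ L_c`. Cutting one superdiagonal entry of `U`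
gives `U_N` and `T_N = G R U_N`, for which the row `e_0ᵀ B_l(T_N)` is `e_lᵀ` if `l < N` and zero if
`l = N` (`aeval_truncOp_typeII`). Hence the functional `P ↦ (P(T_N) G e_0)_0` kills all multiples of
`B_N` and sends `B_l` to `(G e_0)_l` for `l < N`. Row 0 of `G` is `e_0ᵀ`, and `G M = T_N G` for `M =
R U_N G`, so this functional is also `P ↦ P(M)_{00}`. As `M` is a product of nonnegative bidiagonal
factors, the Hankel matrix of its moments is totally nonnegative (`totallyNonneg_hankel`), and the
functional is positive semidefinite. By `exists_quadrature` it is a sum of point masses at real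
zeros of `B_N`; nothing about the reality or simplicity of the other zeros is needed.

All these nodes lie in the compact interval `Δ`, so a limit over `N` yields a probability measure
`μ_c` on `Δ` with `∫ B_l dμ_c = (L_1 ⋯ L_c e_0)_l` (`exists_measure_typeII`). Combining the `μ_c`
with the coefficients of `𝒞` and the normalizations in `𝓛`, the identity `ν^{-⊤} = 𝓛 𝒞` says
precisely that biorthogonality holds for `k < p`; the recurrences carry it to all `k`
(`biorthogonality_of_initial`). -/

/-! ### Total nonnegativity under row operations -/

/-- All minors of the semi-infinite matrix `Z` are nonnegative. -/
def TotallyNonneg (Z : ℕ → ℕ → ℝ) : Prop :=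
  ∀ (k : ℕ) (f g : Fin k → ℕ), StrictMono f → StrictMono g →
    0 ≤ (Matrix.of fun i j => Z (f i) (g j)).det

theorem TotallyNonneg.det_nonneg_of_monotone {Z : ℕ → ℕ → ℝ} (hZ : TotallyNonneg Z) {k : ℕ}
    {f g : Fin k → ℕ} (hf : Monotone f) (hg : StrictMono g) :
    0 ≤ (Matrix.of fun i j => Z (f i) (g j)).det := by
  by_cases hi : Function.Injective f
  · exact hZ k f g (hf.strictMono_of_injective hi) hg
  · obtain ⟨i, j, hij, hne⟩ : ∃ i j, f i = f j ∧ i ≠ j := by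
      simpa [Function.Injective] using hi
    rw [Matrix.det_zero_of_row_eq hne]
    ext l
    simp [hij]

theorem TotallyNonneg.transpose {Z : ℕ → ℕ → ℝ} (hZ : TotallyNonneg Z) :
    TotallyNonneg fun i j => Z j i := by
  intro k f g hf hg
  have := hZ k g f hg hf
  rwa [← Matrix.det_transpose] at this

/-- Replacing the rows by nonnegative combinations of pairs of rows taken in weakly increasing
order preserves total nonnegativity. -/
theorem TotallyNonneg.combine {Z : ℕ → ℕ → ℝ} (hZ : TotallyNonneg Z) {a b : ℕ → ℕ} {d e : ℕ → ℝ}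
    (hd : ∀ i, 0 ≤ d i) (he : ∀ i, 0 ≤ e i)
    (hab : ∀ i j, i < j → a i ≤ a j ∧ a i ≤ b j ∧ b i ≤ a j ∧ b i ≤ b j) :
    TotallyNonneg fun i j => d i * Z (a i) j + e i * Z (b i) j := by
  intro k f g hf hg
  -- Multilinearity in the rows: each term picks one of the two source rows for every `i`, and the
  -- picked rows are weakly increasing.
  have h1 : (Matrix.of fun i j => d (f i) * Z (a (f i)) (g j) + e (f i) * Z (b (f i)) (g j)).det
      = ∑ s : Finset (Fin k), (∏ i, if i ∈ s then d (f i) else e (f i)) *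
        (Matrix.of fun i j => Z (if i ∈ s then a (f i) else b (f i)) (g j)).det := by
    have := Matrix.detRowAlternating.map_add_univ (R := ℝ)
      (fun (i : Fin k) (j : Fin k) => d (f i) * Z (a (f i)) (g j))
      (fun (i : Fin k) (j : Fin k) => e (f i) * Z (b (f i)) (g j))
    refine this.trans (Finset.sum_congr rfl fun s _ => ?_)
    rw [← Matrix.det_mul_column]
    congr 1
    ext i j
    by_cases h : i ∈ s <;> simp [Finset.piecewise, h]
  rw [h1]
  refine Finset.sum_nonneg fun s _ => mul_nonneg (Finset.prod_nonneg fun i _ => ?_) ?_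
  · split_ifs
    exacts [hd _, he _]
  · refine hZ.det_nonneg_of_monotone (f := fun i => if i ∈ s then a (f i) else b (f i)) ?_ hg
    intro i j hij
    rcases hij.eq_or_lt with rfl | hlt
    · rfl
    · have := hab _ _ (hf hlt)
      dsimp only
      split_ifs <;> tauto

theorem totallyNonneg_one : TotallyNonneg fun i j => if i = j then 1 else 0 := by
  intro k f g hf hg
  by_cases h : f = g
  · subst h
    have : (Matrix.of fun i j : Fin k => if f i = f j then (1 : ℝ) else 0) = 1 := by
      ext i j
      simp [Matrix.one_apply, hf.injective.eq_iff]
    rw [this, Matrix.det_one]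
    exact zero_le_one
  -- Strictly increasing maps are determined by their ranges, so two different ones of equal length
  -- leave some row without a one.
  · have h2 : ∃ i, ∀ j, f i ≠ g j := by
      by_contra! hc
      apply h
      rw [← StrictMono.range_inj hf hg]
      choose φ hφ using hc
      have hinj : Function.Injective φ := fun x y hxy => hf.injective (by rw [hφ, hφ, hxy])
      have hsurj := Finite.surjective_of_injective hinj
      ext x
      constructor
      · rintro ⟨i, rfl⟩
        exact ⟨φ i, (hφ i).symm⟩
      · rintro ⟨j, rfl⟩
        obtain ⟨i, rfl⟩ := hsurj j
        exact ⟨i, hφ i⟩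
    obtain ⟨i, hi⟩ := h2
    rw [Matrix.det_eq_zero_of_row_eq_zero i (fun j => by simp [hi j])]

/-- The rows of `pre` with numbers below `n`, followed by the rows of `W`. -/
def stackRows (n : ℕ) (pre W : ℕ → ℕ → ℝ) : ℕ → ℕ → ℝ :=
  fun i => if i < n then pre i else W (i - n)

theorem TotallyNonneg.stack_lower {n : ℕ} {pre W : ℕ → ℕ → ℝ} {d l : ℕ → ℝ} (hd : ∀ i, 0 ≤ d i)
    (hl : ∀ i, 0 ≤ l i) (h : TotallyNonneg (stackRows n pre W)) :
    TotallyNonneg (stackRows n pre fun i j =>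
      d i * W i j + if i = 0 then 0 else l (i - 1) * W (i - 1) j) := by
  -- Row `n` is the first row of `W` and has no predecessor there; its second source is itself with
  -- coefficient zero, so `pre` is never mixed in.
  have := h.combine (a := fun i => i) (b := fun i => if i ≤ n then i else i - 1)
    (d := fun i => if i < n then 1 else d (i - n))
    (e := fun i => if i ≤ n then 0 else l (i - n - 1))
    (fun i => by split_ifs; exacts [zero_le_one, hd _])
    (fun i => by split_ifs; exacts [le_rfl, hl _])
    (fun i j hij => by split_ifs <;> omega)
  convert this using 3 with i j
  unfold stackRows
  rcases lt_trichotomy i n with hi | rfl | hi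
  · simp [hi, hi.le]
  · simp
  · have e1 : ¬ i < n := by omega
    have e2 : ¬ i ≤ n := by omega
    have e3 : ¬ i - n = 0 := by omega
    have e4 : ¬ i - 1 < n := by omega
    have e5 : i - 1 - n = i - n - 1 := by omega
    simp [e1, e2, e3, e4, e5]

theorem TotallyNonneg.stack_upper {n : ℕ} {pre W : ℕ → ℕ → ℝ} {u s : ℕ → ℝ} (hu : ∀ i, 0 ≤ u i)
    (hs : ∀ i, 0 ≤ s i) (h : TotallyNonneg (stackRows n pre W)) :
    TotallyNonneg (stackRows n pre fun i j => u i * W i j + s i * W (i + 1) j) := by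
  have := h.combine (a := fun i => i) (b := fun i => if i < n then i else i + 1)
    (d := fun i => if i < n then 1 else u (i - n)) (e := fun i => if i < n then 0 else s (i - n))
    (fun i => by split_ifs; exacts [zero_le_one, hu _])
    (fun i => by split_ifs; exacts [le_rfl, hs _])
    (fun i j hij => by split_ifs <;> omega)
  convert this using 3 with i j
  unfold stackRows
  by_cases hi : i < n
  · simp [hi]
  · have e4 : ¬ i + 1 < n := by omega
    have e5 : i + 1 - n = i - n + 1 := by omega
    simp [hi, e4, e5]

/-- Repeating a row creates only minors that already occur or vanish. It freezes a copy of the first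
row of `W` before `W` is transformed further. -/
theorem TotallyNonneg.stack_duplicate {n : ℕ} {pre W : ℕ → ℕ → ℝ}
    (h : TotallyNonneg (stackRows n pre W)) :
    TotallyNonneg (stackRows (n + 1) (fun i => if i < n then pre i else W 0) W) := by
  have := h.combine (a := fun i => if i ≤ n then i else i - 1)
    (b := fun i => if i ≤ n then i else i - 1)
    (d := fun _ => 1) (e := fun _ => 0) (fun _ => zero_le_one) (fun _ => le_rfl)
    (fun i j hij => by split_ifs <;> omega)
  convert this using 3 with i j
  unfold stackRows
  rcases lt_trichotomy i n with hi | rfl | hi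
  · simp [hi, hi.le, Nat.lt_succ_of_lt hi]
  · simp
  · have e1 : ¬ i < n + 1 := by omega
    have e2 : ¬ i ≤ n := by omega
    have e4 : ¬ i - 1 < n := by omega
    have e5 : i - 1 - n = i - (n + 1) := by omega
    simp [e1, e2, e4, e5]

/-- A symmetric matrix with nonnegative principal minors is positive semidefinite. -/
theorem posSemidef_of_principal_minors_nonneg {n : ℕ} {H : Matrix (Fin n) (Fin n) ℝ}
    (hH : H.IsHermitian)
    (hm : ∀ (k : ℕ) (f : Fin k → Fin n), StrictMono f → 0 ≤ (H.submatrix f f).det) :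
    H.PosSemidef := by
  have hpos : ∀ y : ℝ, 0 < y → 0 < (H + y • (1 : Matrix (Fin n) (Fin n) ℝ)).det := by
    intro y hy
    have h1 := Matrix.detRowAlternating.map_add_univ (R := ℝ)
      (fun (i : Fin n) (j : Fin n) => H i j)
      (fun (i : Fin n) (j : Fin n) => (y • (1 : Matrix (Fin n) (Fin n) ℝ)) i j)
    have h2 : (H + y • (1 : Matrix (Fin n) (Fin n) ℝ)).det = _ := h1
    -- Each term of the expansion is a principal minor of `H` times a power of `y`.
    have key : ∀ s : Finset (Fin n), 0 ≤ (Matrix.detRowAlternating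
        (s.piecewise (fun (i : Fin n) (j : Fin n) => H i j)
        (fun (i : Fin n) (j : Fin n) => (y • (1 : Matrix (Fin n) (Fin n) ℝ)) i j)) : ℝ) := by
      intro s
      set A : Matrix (Fin n) (Fin n) ℝ := s.piecewise (fun (i : Fin n) (j : Fin n) => H i j)
        (fun (i : Fin n) (j : Fin n) => (y • (1 : Matrix (Fin n) (Fin n) ℝ)) i j) with hA
      change 0 ≤ A.det
      have hA1 : ∀ i ∈ s, ∀ j, A i j = H i j := fun i hi j => by simp [hA, hi]
      have hA2 : ∀ i, i ∉ s → ∀ j, A i j = if i = j then y else 0 := fun i hi j => by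
        simp [hA, hi, Matrix.one_apply]
      rw [Matrix.twoBlockTriangular_det A (· ∈ s)]
      · refine mul_nonneg ?_ ?_
        · have e := s.orderIsoOfFin rfl
          have hd := Matrix.det_submatrix_equiv_self e.toEquiv (A.toSquareBlockProp (· ∈ s))
          have h0 := hm s.card (fun i => (e i : Fin n)) fun i j hij => e.strictMono hij
          have h3 : (A.toSquareBlockProp (· ∈ s)).submatrix e.toEquiv e.toEquiv
              = H.submatrix (fun i => (e i : Fin n)) (fun i => (e i : Fin n)) := by
            ext i j
            simp [Matrix.toSquareBlockProp, hA1 _ (e i).2]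
          rw [h3] at hd
          rw [hd] at h0
          convert h0
          rfl
        · have : A.toSquareBlockProp (fun i => ¬ i ∈ s) = Matrix.diagonal fun _ => y := by
            ext i j
            simp [Matrix.toSquareBlockProp, hA2 _ i.2, Matrix.diagonal, Subtype.ext_iff]
          rw [this, Matrix.det_diagonal]
          exact Finset.prod_nonneg fun _ _ => hy.le
      · intro i hi j hj
        rw [hA2 i hi, if_neg]
        rintro rfl
        exact hi hj
    rw [h2]
    refine Finset.sum_pos' (fun s _ => key s) ⟨∅, Finset.mem_univ _, ?_⟩
    rw [Finset.piecewise_empty]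
    change 0 < (y • (1 : Matrix (Fin n) (Fin n) ℝ)).det
    rw [Matrix.det_smul, Matrix.det_one, mul_one]
    exact pow_pos hy _
  rw [hH.posSemidef_iff_eigenvalues_nonneg]
  intro i
  by_contra hneg
  have hlt : hH.eigenvalues i < 0 := not_le.mp hneg
  -- With `y = -λ` for a negative eigenvalue `λ`, the eigenvector makes `H + y` singular.
  have h1 := hpos _ (neg_pos.mpr hlt)
  refine h1.ne' ?_
  rw [← Matrix.exists_mulVec_eq_zero_iff]
  refine ⟨WithLp.ofLp (hH.eigenvectorBasis i), ?_, ?_⟩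
  · intro h0
    have := hH.eigenvectorBasis.orthonormal.ne_zero i
    exact this (by ext j; exact congrFun h0 j)
  · rw [Matrix.add_mulVec, hH.mulVec_eigenvectorBasis, Matrix.smul_mulVec, Matrix.one_mulVec]
    simp

/-! ### Products of bidiagonal operators: Krylov and Hankel matrices -/

/-- Multiplication by the lower bidiagonal matrix with ones on the diagonal and `l` below it. -/
def lowerOp (l : ℕ → ℝ) : Module.End ℝ (ℕ → ℝ) where
  toFun y i := y i + if i = 0 then 0 else l (i - 1) * y (i - 1)
  map_add' x y := by
    ext i
    simp only [Pi.add_apply]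
    split_ifs <;> ring
  map_smul' c y := by
    ext i
    simp only [Pi.smul_apply, smul_eq_mul, RingHom.id_apply]
    split_ifs <;> ring

/-- Multiplication by the upper bidiagonal matrix with diagonal `u` and superdiagonal `s`. -/
def upperOp (u s : ℕ → ℝ) : Module.End ℝ (ℕ → ℝ) where
  toFun y i := u i * y i + s i * y (i + 1)
  map_add' x y := by
    ext i
    simp only [Pi.add_apply]
    ring
  map_smul' c y := by
    ext i
    simp only [Pi.smul_apply, smul_eq_mul, RingHom.id_apply]
    ring

theorem lowerOp_apply (l y : ℕ → ℝ) (i : ℕ) :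
    lowerOp l y i = y i + if i = 0 then 0 else l (i - 1) * y (i - 1) := rfl

theorem upperOp_apply (u s y : ℕ → ℝ) (i : ℕ) :
    upperOp u s y i = u i * y i + s i * y (i + 1) := rfl

theorem lowerOp_single (l : ℕ → ℝ) (k : ℕ) :
    lowerOp l (Pi.single k 1) = Pi.single k 1 + l k • Pi.single (k + 1) 1 := by
  ext i
  simp only [lowerOp_apply, Pi.single_apply, Pi.add_apply, Pi.smul_apply, smul_eq_mul]
  rcases i with _ | i
  · simp
  · by_cases h : i = k
    · subst h; simp
    · simp [h]

theorem upperOp_single (u s : ℕ → ℝ) (k : ℕ) :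
    upperOp u s (Pi.single k 1)
      = u k • Pi.single k 1 + if k = 0 then 0 else s (k - 1) • Pi.single (k - 1) 1 := by
  ext i
  rcases k with _ | k
  · by_cases h : i = 0 <;> simp [upperOp_apply, h]
  · by_cases h : i = k + 1
    · subst h; simp [upperOp_apply]
    · by_cases h' : i = k
      · subst h'; simp [upperOp_apply]
      · simp [upperOp_apply, h, h']

/-- The products of nonnegative bidiagonal operators. -/
def bidiagonalMonoid : Submonoid (Module.End ℝ (ℕ → ℝ)) :=
  Submonoid.closure ({A | ∃ l : ℕ → ℝ, (∀ i, 0 ≤ l i) ∧ A = lowerOp l} ∪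
    {A | ∃ u s : ℕ → ℝ, (∀ i, 0 ≤ u i) ∧ (∀ i, 0 ≤ s i) ∧ A = upperOp u s})

theorem TotallyNonneg.stack_rows_map {M : Module.End ℝ (ℕ → ℝ)} (hM : M ∈ bidiagonalMonoid)
    {n : ℕ} {pre W : ℕ → ℕ → ℝ} (h : TotallyNonneg (stackRows n pre W)) :
    TotallyNonneg (stackRows n pre fun i j => M (fun r => W r j) i) := by
  induction hM using Submonoid.closure_induction generalizing W with
  | mem A hA =>
    rcases hA with ⟨l, hl, rfl⟩ | ⟨u, s, hu, hs, rfl⟩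
    · simpa [lowerOp_apply] using h.stack_lower (d := fun _ => 1) (fun _ => zero_le_one) hl
    · exact h.stack_upper hu hs
  | one => exact h
  | mul A B _ _ hA hB => exact hA (hB h)

/-- The stacked rows are the columns of `A`, on which right multiplication acts by the transpose; so
a lower factor is handled by `stack_upper` and an upper one by `stack_lower`. -/
theorem TotallyNonneg.stack_columns_map {M : Module.End ℝ (ℕ → ℝ)} (hM : M ∈ bidiagonalMonoid)
    {n : ℕ} {pre : ℕ → ℕ → ℝ} (A : Module.End ℝ (ℕ → ℝ))
    (h : TotallyNonneg (stackRows n pre fun k => A (Pi.single k 1))) :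
    TotallyNonneg (stackRows n pre fun k => A (M (Pi.single k 1))) := by
  induction hM using Submonoid.closure_induction generalizing A with
  | mem B hB =>
    rcases hB with ⟨l, hl, rfl⟩ | ⟨u, s, hu, hs, rfl⟩
    · convert h.stack_upper (u := fun _ => 1) (fun _ => zero_le_one) hl using 3 with i j
      rw [lowerOp_single]
      ext j
      simp
    · convert h.stack_lower hu hs using 3 with i j
      rw [upperOp_single]
      ext j
      split_ifs <;> simp
  | one => exact h
  | mul B C _ _ hB hC => exact hC (A * B) (hB A h)

theorem TotallyNonneg.of_stack {pre : ℕ → ℕ → ℝ} {W : ℕ → ℕ → ℕ → ℝ}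
    (h : ∀ n, TotallyNonneg (stackRows n pre (W n))) : TotallyNonneg pre := by
  intro k f g hf hg
  -- A stack height exceeding every row number in the minor.
  have := h (∑ i, f i + 1) k f g hf hg
  convert this using 4 with i
  have : f i ≤ ∑ i, f i := Finset.single_le_sum (fun _ _ => Nat.zero_le _) (Finset.mem_univ i)
  simp [stackRows, Nat.lt_succ_of_le this]

variable {M : Module.End ℝ (ℕ → ℝ)}

/-- Below the frozen rows `e_0, M e_0, …, M^{n-1} e_0` stand all columns of `M^n`. Duplicating the
first of these and multiplying by `M` on the right passes from `n` to `n + 1`. -/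
theorem totallyNonneg_krylov (hM : M ∈ bidiagonalMonoid) :
    TotallyNonneg fun k => (M ^ k) (Pi.single 0 1) := by
  refine TotallyNonneg.of_stack (W := fun n k => (M ^ n) (Pi.single k 1)) fun n => ?_
  induction n with
  | zero =>
    convert totallyNonneg_one using 3 with i j
    simp [stackRows, Pi.single_apply, eq_comm]
  | succ n ih =>
    have := TotallyNonneg.stack_columns_map hM (M ^ n) ih.stack_duplicate
    convert this using 1
    ext i j
    unfold stackRows
    rcases lt_trichotomy i n with hi | rfl | hi
    · simp [hi, Nat.lt_succ_of_lt hi]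
    · simp
    · have e1 : ¬ i < n + 1 := by omega
      simp [e1, pow_succ]

/-- The same freezing scheme, started from the transposed Krylov matrix: row 0 is duplicated, then
`M` acts on the rows from the left and raises every exponent by one. -/
theorem totallyNonneg_hankel (hM : M ∈ bidiagonalMonoid) :
    TotallyNonneg fun i j => (M ^ (i + j)) (Pi.single 0 1) 0 := by
  refine TotallyNonneg.of_stack (W := fun n i j => (M ^ (n + j)) (Pi.single 0 1) i) fun n => ?_
  induction n with
  | zero =>
    convert (totallyNonneg_krylov hM).transpose using 3 with i j
    simp [stackRows]
  | succ n ih =>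
    have := ih.stack_duplicate.stack_rows_map hM
    convert this using 1
    ext i j
    unfold stackRows
    rcases lt_trichotomy i n with hi | rfl | hi
    · simp [hi, Nat.lt_succ_of_lt hi]
    · simp
    · have e1 : ¬ i < n + 1 := by omega
      simp only [e1, if_false]
      rw [show n + 1 + j = n + j + 1 by ring, pow_succ']
      rfl

/-! ### Positive semidefinite functionals and quadrature -/

/-- The linear functional `P ↦ P(M)₀₀`. -/
noncomputable def cornerFunctional (M : Module.End ℝ (ℕ → ℝ)) : ℝ[X] →ₗ[ℝ] ℝ :=
  LinearMap.proj 0 ∘ₗ LinearMap.applyₗ (Pi.single 0 1 : ℕ → ℝ) ∘ₗ (aeval M).toLinearMap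

theorem cornerFunctional_apply (P : ℝ[X]) :
    cornerFunctional M P = aeval M P (Pi.single 0 1) 0 := rfl

theorem cornerFunctional_mul_self_nonneg (hM : M ∈ bidiagonalMonoid) (P : ℝ[X]) :
    0 ≤ cornerFunctional M (P * P) := by
  set d := P.natDegree + 1
  let H : Matrix (Fin d) (Fin d) ℝ := Matrix.of fun i j => (M ^ (i + j : ℕ)) (Pi.single 0 1) 0
  have hH : H.PosSemidef := by
    refine posSemidef_of_principal_minors_nonneg ?_ fun k f hf => ?_
    · ext i j
      simp [H, add_comm]
    · exact totallyNonneg_hankel hM k (fun i => f i) (fun i => f i) (fun i j h => hf h)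
        fun i j h => hf h
  have h1 := hH.dotProduct_mulVec_nonneg fun i : Fin d => P.coeff i
  refine h1.trans_eq (Eq.symm ?_)
  have hP : P = ∑ i : Fin d, C (P.coeff i) * X ^ (i : ℕ) := by
    conv_lhs => rw [P.as_sum_range_C_mul_X_pow, Finset.sum_range]
  conv_lhs => rw [hP, Finset.sum_mul_sum]
  simp only [map_sum, dotProduct, Matrix.mulVec, star_trivial, Finset.mul_sum]
  refine Finset.sum_congr rfl fun i _ => Finset.sum_congr rfl fun j _ => ?_
  have : C (P.coeff i) * X ^ (i : ℕ) * (C (P.coeff j) * X ^ (j : ℕ))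
      = (P.coeff i * P.coeff j) • (X ^ (i + j : ℕ) : ℝ[X]) := by
    rw [smul_eq_C_mul, C_mul, pow_add]
    ring
  rw [this, map_smul, cornerFunctional_apply]
  simp [H]
  ring

/-- Cauchy–Schwarz for isotropic vectors of a positive semidefinite functional. -/
theorem map_mul_eq_zero_of_map_mul_self_eq_zero {ℓ : ℝ[X] →ₗ[ℝ] ℝ} (hpos : ∀ P, 0 ≤ ℓ (P * P))
    {P : ℝ[X]} (hP : ℓ (P * P) = 0) (Q : ℝ[X]) : ℓ (P * Q) = 0 := by
  have key : ∀ t : ℝ, 0 ≤ ℓ (Q * Q) + 2 * t * ℓ (P * Q) := by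
    intro t
    have h := hpos (Q + t • P)
    have e : (Q + t • P) * (Q + t • P) = Q * Q + (2 * t) • (P * Q) + (t * t) • (P * P) := by
      simp only [smul_eq_C_mul, C_mul, map_ofNat]
      ring
    rw [e, map_add, map_add, map_smul, map_smul, hP] at h
    simpa using h
  by_contra h0
  -- This `t` makes the affine expression in `key` equal to `-1`.
  have := key (-(ℓ (Q * Q) + 1) / (2 * ℓ (P * Q)))
  have e : 2 * (-(ℓ (Q * Q) + 1) / (2 * ℓ (P * Q))) * ℓ (P * Q) = -(ℓ (Q * Q) + 1) := by
    field_simp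
  rw [e] at this
  linarith

theorem not_mul_dvd_right {h q : ℝ[X]} (hq : h * q ≠ 0) (hd : 0 < h.natDegree) : ¬ h * q ∣ q := by
  intro hdvd
  have h1 := natDegree_le_of_dvd hdvd (right_ne_zero_of_mul hq)
  rw [natDegree_mul (left_ne_zero_of_mul hq) (right_ne_zero_of_mul hq)] at h1
  omega

/-- The annihilator of a positive semidefinite functional is generated by a polynomial which is a
constant times the product of its distinct real linear factors. -/
theorem prod_roots_dvd_of_generator {ℓ : ℝ[X] →ₗ[ℝ] ℝ} (hpos : ∀ P, 0 ≤ ℓ (P * P)) {g : ℝ[X]}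
    (hg0 : g ≠ 0) (hg : ∀ P, g ∣ P ↔ ∀ Q, ℓ (P * Q) = 0) {P : ℝ[X]}
    (hP : ∀ x, g.IsRoot x → P.IsRoot x) : g ∣ P := by
  have hiso : ∀ r, ℓ (r * r) = 0 → g ∣ r := fun r hr =>
    (hg r).2 (map_mul_eq_zero_of_map_mul_self_eq_zero hpos hr)
  have hnodup : g.roots.Nodup := by
    rw [Multiset.nodup_iff_count_le_one]
    intro a
    by_contra! hc
    rw [count_roots] at hc
    obtain ⟨q, hq⟩ := (le_rootMultiplicity_iff hg0 (n := 2)).1 hc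
    -- If `g = (X - a)² q`, then `((X - a) q)² = g q` is annihilated, so `g` would divide a
    -- polynomial of smaller degree.
    have h1 : ℓ (((X - C a) * q) * ((X - C a) * q)) = 0 := by
      have := (hg g).1 dvd_rfl q
      rw [hq] at this
      rw [← this]
      congr 1
      ring
    have h2 := hiso _ h1
    have h3 : g = (X - C a) * ((X - C a) * q) := by rw [hq]; ring
    rw [h3] at h2
    exact not_mul_dvd_right (h3 ▸ hg0) (by rw [natDegree_X_sub_C]; exact one_pos) h2
  obtain ⟨q, hq, -, hroots⟩ := exists_prod_multiset_X_sub_C_mul g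
  have hq0 : q ≠ 0 := by
    rintro rfl
    exact hg0 (by rw [← hq, mul_zero])
  have hunit : IsUnit q := by
    by_contra hnu
    obtain ⟨z, hz⟩ : ∃ z : ℂ, aeval z q = 0 := by
      refine IsAlgClosed.exists_aeval_eq_zero _ q ?_
      rwa [Ne, ← isUnit_iff_degree_eq_zero]
    by_cases him : z.im = 0
    · have h1 : q.IsRoot z.re := by
        have e : z = algebraMap ℝ ℂ z.re := Complex.ext rfl (by simpa using him)
        rw [e, aeval_algebraMap_apply] at hz
        simpa [IsRoot] using hz
      have : z.re ∈ q.roots := (mem_roots hq0).2 h1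
      simp [hroots] at this
    · have hdvd := (q.quadratic_dvd_of_aeval_eq_zero_im_ne_zero hz him).trans
        (Dvd.intro_left _ hq)
      have e : (X ^ 2 - C (2 * z.re) * X + C (‖z‖ ^ 2) : ℝ[X])
          = (X - C z.re) * (X - C z.re) + C (z.im * z.im) := by
        rw [← Complex.normSq_eq_norm_sq, Complex.normSq_apply]
        simp only [C_mul, C_add, map_ofNat]
        ring
      have hdeg : 0 < ((X - C z.re) * (X - C z.re) + C (z.im * z.im)).natDegree := by
        rw [natDegree_add_C, natDegree_mul (X_sub_C_ne_zero _) (X_sub_C_ne_zero _),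
          natDegree_X_sub_C]
        norm_num
      rw [e] at hdvd
      obtain ⟨r, hr⟩ := hdvd
      have h1 := (hg g).1 dvd_rfl r
      -- A nonreal zero gives `g = ((X - Re z)² + (Im z)²) r`, so `g r` is a sum of squares killed
      -- by `ℓ`; hence `r` is isotropic and `g ∣ r`, against degrees.
      have e2 : g * r = ((X - C z.re) * r) * ((X - C z.re) * r)
          + (z.im * z.im) • (r * r) := by
        rw [hr, smul_eq_C_mul]
        ring
      rw [e2, map_add, map_smul, smul_eq_mul] at h1
      have h2 := hpos ((X - C z.re) * r)
      have h3 := hpos r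
      have h4 : 0 < z.im * z.im := mul_self_pos.2 him
      have h5 : ℓ (r * r) = 0 := by
        by_contra h
        have : 0 < ℓ (r * r) := lt_of_le_of_ne h3 (Ne.symm h)
        nlinarith [mul_pos h4 this]
      have h6 := hiso r h5
      rw [hr] at h6
      exact not_mul_dvd_right (hr ▸ hg0) hdeg h6
  rcases eq_or_ne P 0 with rfl | hP0
  · exact dvd_zero _
  · rw [← hq, hunit.mul_right_dvd, Multiset.prod_X_sub_C_dvd_iff_le_roots hP0,
      Multiset.le_iff_subset hnodup]
    intro x hx
    exact (mem_roots hP0).2 (hP x ((mem_roots hg0).1 hx))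

/-- A positive semidefinite functional that annihilates the multiples of `χ` is a positive
combination of evaluations at real zeros of `χ`. -/
theorem exists_quadrature {ℓ : ℝ[X] →ₗ[ℝ] ℝ} (hpos : ∀ P, 0 ≤ ℓ (P * P)) {χ : ℝ[X]} (hχ0 : χ ≠ 0)
    (hχ : ∀ Q, ℓ (χ * Q) = 0) :
    ∃ (s : Finset ℝ) (w : ℝ → ℝ), (∀ x ∈ s, χ.IsRoot x) ∧ (∀ x ∈ s, 0 ≤ w x) ∧
      ∀ P, ℓ P = ∑ x ∈ s, w x * P.eval x := by
  let K : Ideal ℝ[X] :=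
    { carrier := {P | ∀ Q, ℓ (P * Q) = 0}
      add_mem' := fun {a b} ha hb Q => by rw [add_mul, map_add, ha, hb, add_zero]
      zero_mem' := fun Q => by rw [zero_mul, map_zero]
      smul_mem' := fun c P hP Q => by
        rw [smul_eq_mul, mul_comm c P, mul_assoc]
        exact hP _ }
  set g := Submodule.IsPrincipal.generator K
  have hg : ∀ P, g ∣ P ↔ ∀ Q, ℓ (P * Q) = 0 := fun P =>
    (Submodule.IsPrincipal.mem_iff_generator_dvd K).symm
  have hgχ : g ∣ χ := (hg χ).2 hχ
  have hg0 : g ≠ 0 := ne_zero_of_dvd_ne_zero hχ0 hgχ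
  set s := g.roots.toFinset
  have hs : ∀ x, x ∈ s ↔ g.IsRoot x := fun x => by simp [s, hg0]
  have hinj : Set.InjOn (id : ℝ → ℝ) s := Function.injective_id.injOn
  have hℓ : ∀ P Q : ℝ[X], (∀ x ∈ s, P.eval x = Q.eval x) → ℓ P = ℓ Q := by
    intro P Q h
    have h1 := (hg (P - Q)).1 (prod_roots_dvd_of_generator hpos hg0 hg fun x hx => by
      simp [IsRoot, h x ((hs x).2 hx)]) 1
    rwa [mul_one, map_sub, sub_eq_zero] at h1
  refine ⟨s, fun x => ℓ (Lagrange.basis s id x), fun x hx => ((hs x).1 hx).dvd hgχ,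
    fun x hx => ?_, fun P => ?_⟩
  · dsimp only
    -- A Lagrange basis polynomial agrees with its square at the nodes, so its weight is the value
    -- of `ℓ` at a square.
    rw [hℓ _ (Lagrange.basis s id x * Lagrange.basis s id x)]
    · exact hpos _
    · intro y hy
      rw [eval_mul]
      rcases eq_or_ne x y with rfl | hne
      · have := Lagrange.eval_basis_self hinj hx
        rw [id] at this
        rw [this, mul_one]
      · have := Lagrange.eval_basis_of_ne (v := (id : ℝ → ℝ)) hne hy
        rw [id] at this
        rw [this, mul_zero]
  · rw [hℓ P (Lagrange.interpolate s id fun x => P.eval x)]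
    · rw [Lagrange.interpolate_apply, map_sum]
      refine Finset.sum_congr rfl fun x _ => ?_
      rw [← smul_eq_C_mul, map_smul, smul_eq_mul, mul_comm]
    · intro y hy
      exact (Lagrange.eval_interpolate_at_node (fun x => P.eval x) hinj hy).symm

/-! ### Truncated factorization and the type II polynomials -/

/-- The product `L_1 ⋯ L_k` as an operator on sequences. -/
def lowerProdOp (p : ℕ) (α : ℕ → ℝ) : ℕ → Module.End ℝ (ℕ → ℝ)
  | 0 => 1
  | k + 1 => lowerProdOp p α k * lowerOp fun j => α (k + 1 + 1 + j * (p + 1))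

/-- The factor `U`, with the superdiagonal entry of row `N - 1` replaced by zero. -/
def truncUpperOp (p : ℕ) (α : ℕ → ℝ) (N : ℕ) : Module.End ℝ (ℕ → ℝ) :=
  upperOp (fun j => α (1 + j * (p + 1))) fun j => if j + 1 = N then 0 else 1

/-- The product `L_1 ⋯ L_p U`, with `U` truncated as in `truncUpperOp`. -/
def truncOp (p : ℕ) (α : ℕ → ℝ) (N : ℕ) : Module.End ℝ (ℕ → ℝ) :=
  lowerProdOp p α p * truncUpperOp p α N

variable {p : ℕ} {α : ℕ → ℝ} {T : Matrix ℕ ℕ ℝ}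

theorem infMul_lowerFactor (A : Matrix ℕ ℕ ℝ) (k i j : ℕ) :
    infMul A (lowerFactor p α k) i j = A i j + A i (j + 1) * α (k + 1 + j * (p + 1)) := by
  rw [infMul, Matrix.of_apply, finsum_eq_sum_of_support_subset (s := {j, j + 1})]
  · rw [Finset.sum_pair (by omega)]
    simp [lowerFactor]
  · intro m hm
    contrapose! hm
    simp only [Finset.coe_insert, Finset.coe_singleton, Set.mem_insert_iff,
      Set.mem_singleton_iff, not_or] at hm
    simp [lowerFactor, hm.1, hm.2]

theorem infMul_upperFactor (A : Matrix ℕ ℕ ℝ) (i j : ℕ) :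
    infMul A (upperFactor p α) i j
      = A i j * α (1 + j * (p + 1)) + if j = 0 then 0 else A i (j - 1) := by
  rcases j with _ | j
  · rw [infMul, Matrix.of_apply, finsum_eq_single _ 0]
    · simp [upperFactor]
    · intro m hm
      simp [upperFactor, hm]
  · rw [infMul, Matrix.of_apply, finsum_eq_sum_of_support_subset (s := {j, j + 1})]
    · rw [Finset.sum_pair (by omega)]
      simp [upperFactor, add_comm]
    · intro m hm
      contrapose! hm
      simp only [Finset.coe_insert, Finset.coe_singleton, Set.mem_insert_iff,
        Set.mem_singleton_iff, not_or] at hm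
      simp [upperFactor, hm.2, Ne.symm hm.1]

theorem lowerProdOp_single (k i j : ℕ) :
    lowerProdOp p α k (Pi.single j 1) i = lowerProd p α k i j := by
  induction k generalizing j with
  | zero => simp [lowerProdOp, lowerProd, Matrix.one_apply, Pi.single_apply]
  | succ k ih =>
    rw [lowerProd, infMul_lowerFactor, lowerProdOp, Module.End.mul_apply, lowerOp_single, map_add,
      map_smul, Pi.add_apply, Pi.smul_apply, ih, ih, smul_eq_mul, mul_comm]

theorem truncOp_zero_single (hT : T = infMul (lowerProd p α p) (upperFactor p α)) (i j : ℕ) :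
    truncOp p α 0 (Pi.single j 1) i = T i j := by
  rw [hT, infMul_upperFactor, truncOp, Module.End.mul_apply, truncUpperOp, upperOp_single, map_add,
    map_smul, Pi.add_apply, Pi.smul_apply, lowerProdOp_single, smul_eq_mul, mul_comm]
  rcases j with _ | j
  · simp
  · simp [lowerProdOp_single]

theorem lowerProdOp_congr {y z : ℕ → ℝ} (k : ℕ) {i : ℕ} (h : ∀ j ≤ i, y j = z j) :
    lowerProdOp p α k y i = lowerProdOp p α k z i := by
  induction k generalizing y z with
  | zero => exact h i le_rfl
  | succ k ih =>
    refine ih fun j hj => ?_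
    rw [lowerOp_apply, lowerOp_apply, h j hj, h (j - 1) (by omega)]

theorem lowerProdOp_apply_zero (k : ℕ) (y : ℕ → ℝ) : lowerProdOp p α k y 0 = y 0 := by
  induction k generalizing y with
  | zero => rfl
  | succ k ih => simp [lowerProdOp, ih, lowerOp_apply]

theorem lowerProdOp_single_zero_eq_zero {k i : ℕ} (h : k < i) :
    lowerProdOp p α k (Pi.single 0 1) i = 0 := by
  have key : ∀ (k : ℕ) (y : ℕ → ℝ) (m : ℕ), (∀ j, m < j → y j = 0) → ∀ i, m + k < i →
      lowerProdOp p α k y i = 0 := by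
    intro k
    induction k with
    | zero => exact fun y m hy i hi => hy i hi
    | succ k ih =>
      intro y m hy i hi
      refine ih _ (m + 1) (fun j hj => ?_) i (by omega)
      rw [lowerOp_apply, hy j (by omega), hy (j - 1) (by omega)]
      simp
  exact key k _ 0 (fun j hj => Pi.single_eq_of_ne (by omega) _) i (by omega)

theorem truncOp_zero_apply (hT : T = infMul (lowerProd p α p) (upperFactor p α)) (y : ℕ → ℝ)
    (i : ℕ) : truncOp p α 0 y i = ∑ j ∈ Finset.range (i + 2), T i j * y j := by
  have h1 : truncOp p α 0 y i
      = truncOp p α 0 (∑ j ∈ Finset.range (i + 2), y j • Pi.single j 1) i := by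
    refine lowerProdOp_congr _ fun j hj => ?_
    have e : ∀ m < i + 2, (∑ j ∈ Finset.range (i + 2), y j • (Pi.single j 1 : ℕ → ℝ)) m = y m := by
      intro m hm
      simp [Finset.sum_apply, Pi.single_apply, hm]
    rw [truncUpperOp, upperOp_apply, upperOp_apply, e j (by omega), e (j + 1) (by omega)]
  rw [h1, map_sum, Finset.sum_apply]
  refine Finset.sum_congr rfl fun j _ => ?_
  rw [map_smul, Pi.smul_apply, truncOp_zero_single hT, smul_eq_mul, mul_comm]

theorem truncOp_apply (hT : T = infMul (lowerProd p α p) (upperFactor p α)) (y : ℕ → ℝ)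
    {i N : ℕ} (hi : i < N) :
    truncOp p α N y i
      = ∑ j ∈ Finset.range (i + 2), T i j * if j = N then 0 else y j := by
  rw [← truncOp_zero_apply hT fun j => if j = N then 0 else y j]
  refine lowerProdOp_congr _ fun j hj => ?_
  rw [truncUpperOp, truncUpperOp, upperOp_apply, upperOp_apply, if_neg (by omega : ¬ j = N),
    if_neg (by omega : ¬ j + 1 = 0)]
  split_ifs <;> simp

/-- The recurrence for `B_l` is the one that builds `e_lᵀ` from `e_0ᵀ` by multiplication by `T_N` on
the right; the cut entry makes the next vector vanish at `l = N`. -/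
theorem aeval_truncOp_typeII (hT : IsMonicBandedHessenberg p T)
    (hfac : T = infMul (lowerProd p α p) (upperFactor p α)) {N : ℕ} (hN : 0 < N) {l : ℕ}
    (hl : l ≤ N) (y : ℕ → ℝ) :
    aeval (truncOp p α N) (typeII T l) y 0 = if l = N then 0 else y l := by
  induction l using Nat.strong_induction_on generalizing y with
  | _ l ih =>
    rcases l with _ | l
    · rw [typeII, if_neg hN.ne]
      simp
    · rw [typeII, mul_comm X, map_sub, map_mul, aeval_X, map_sum, LinearMap.sub_apply,
        Module.End.mul_apply, Pi.sub_apply, ih l (by omega) (by omega), if_neg (by omega),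
        truncOp_apply hfac y (by omega), Finset.sum_range_succ, hT.superdiag, one_mul,
        LinearMap.sum_apply, Finset.sum_apply, Finset.sum_range, sub_eq_iff_eq_add, add_comm]
      congr 1
      refine Finset.sum_congr rfl fun j _ => ?_
      have := j.2
      rw [map_mul, aeval_C, Module.End.mul_apply, Module.algebraMap_end_apply, Pi.smul_apply,
        ih j (by omega) (by omega), smul_eq_mul]

theorem typeII_ne_zero (hT : IsMonicBandedHessenberg p T)
    (hfac : T = infMul (lowerProd p α p) (upperFactor p α)) (n : ℕ) : typeII T n ≠ 0 := by
  intro h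
  have := aeval_truncOp_typeII hT hfac n.succ_pos n.le_succ (Pi.single n 1)
  simp [h] at this

theorem aeval_mul_of_semiconj {G M S : Module.End ℝ (ℕ → ℝ)} (h : G * M = S * G) (P : ℝ[X]) :
    G * aeval M P = aeval S P * G := by
  induction P using Polynomial.induction_on' with
  | add P Q hP hQ => rw [map_add, map_add, mul_add, add_mul, hP, hQ]
  | monomial n a =>
    have hn : G * M ^ n = S ^ n * G := SemiconjBy.pow_right h n
    rw [aeval_monomial, aeval_monomial, mul_assoc, ← hn, ← mul_assoc, ← mul_assoc,
      Algebra.commutes]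

theorem lowerOp_mem_bidiagonalMonoid {l : ℕ → ℝ} (hl : ∀ i, 0 ≤ l i) :
    lowerOp l ∈ bidiagonalMonoid :=
  Submonoid.subset_closure (Or.inl ⟨l, hl, rfl⟩)

theorem truncUpperOp_mem_bidiagonalMonoid (hα : ∀ i, 1 ≤ i → 0 < α i) (N : ℕ) :
    truncUpperOp p α N ∈ bidiagonalMonoid :=
  Submonoid.subset_closure (Or.inr ⟨_, _, fun i => (hα _ (by omega)).le,
    fun i => by split_ifs; exacts [le_rfl, zero_le_one], rfl⟩)

theorem lowerProdOp_mem_bidiagonalMonoid (hα : ∀ i, 1 ≤ i → 0 < α i) (k : ℕ) :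
    lowerProdOp p α k ∈ bidiagonalMonoid := by
  induction k with
  | zero => exact one_mem _
  | succ k ih =>
    exact mul_mem ih (lowerOp_mem_bidiagonalMonoid fun i => (hα _ (by omega)).le)

theorem exists_lowerProdOp_add_eq_mul (hα : ∀ i, 1 ≤ i → 0 < α i) (c m : ℕ) :
    ∃ R ∈ bidiagonalMonoid, lowerProdOp p α (c + m) = lowerProdOp p α c * R := by
  induction m with
  | zero => exact ⟨1, one_mem _, (mul_one _).symm⟩
  | succ m ih =>
    obtain ⟨R, hR, h⟩ := ih
    refine ⟨R * lowerOp fun j => α (c + m + 1 + 1 + j * (p + 1)), mul_mem hR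
      (lowerOp_mem_bidiagonalMonoid fun i => (hα _ (by omega)).le), ?_⟩
    rw [← mul_assoc, ← h]
    rfl

/-- A positive quadrature formula at zeros of `typeII T N`, whose integrals of the first `N` type II
polynomials are the entries of `L_1 ⋯ L_c e_1`. -/
theorem exists_quadrature_typeII (hT : IsMonicBandedHessenberg p T)
    (hα : IsPositiveBidiagonalFactorization p α T) {c : ℕ} (hc : c ≤ p) {N : ℕ} (hN : 0 < N) :
    ∃ (s : Finset ℝ) (w : ℝ → ℝ), (∀ x ∈ s, (typeII T N).IsRoot x) ∧ (∀ x ∈ s, 0 ≤ w x) ∧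
      ∀ l < N, ∑ x ∈ s, w x * (typeII T l).eval x = lowerProdOp p α c (Pi.single 0 1) l := by
  obtain ⟨hpos, hfac⟩ := hα
  obtain ⟨m, rfl⟩ := Nat.exists_eq_add_of_le hc
  obtain ⟨R, hR, hRe⟩ := exists_lowerProdOp_add_eq_mul (p := c + m) hpos c m
  set G := lowerProdOp (c + m) α c
  -- Cyclic rotation of the factors: `G` moves from the front of the truncated product to its end.
  set M := R * truncUpperOp (c + m) α N * G with hM
  have hMmem : M ∈ bidiagonalMonoid := mul_mem (mul_mem hR
    (truncUpperOp_mem_bidiagonalMonoid hpos N)) (lowerProdOp_mem_bidiagonalMonoid hpos c)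
  have hGM : G * M = truncOp (c + m) α N * G := by
    rw [truncOp, hRe, hM]
    simp only [mul_assoc]
  have hℓ : ∀ P, cornerFunctional M P
      = aeval (truncOp (c + m) α N) P (G (Pi.single 0 1)) 0 := by
    intro P
    rw [cornerFunctional_apply, ← Module.End.mul_apply, ← aeval_mul_of_semiconj hGM,
      Module.End.mul_apply, lowerProdOp_apply_zero]
  obtain ⟨s, w, hs, hw, hsum⟩ := exists_quadrature (cornerFunctional_mul_self_nonneg hMmem)
    (typeII_ne_zero hT hfac N) fun Q => by
      rw [hℓ, map_mul, Module.End.mul_apply, aeval_truncOp_typeII hT hfac hN le_rfl, if_pos rfl]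
  refine ⟨s, w, hs, hw, fun l hl => ?_⟩
  rw [← hsum, hℓ, aeval_truncOp_typeII hT hfac hN hl.le, if_neg hl.ne]

/-! ### Location of the zeros -/

theorem eval_X_mul_typeII (hT : IsMonicBandedHessenberg p T) (x : ℝ) (n : ℕ) :
    ∑ j ∈ Finset.range (n + 2), T n j * (typeII T j).eval x = x * (typeII T n).eval x := by
  rw [Finset.sum_range_succ, hT.superdiag, one_mul, typeII, Finset.sum_range]
  simp [eval_finsetSum]

/-- Inverting a nonnegative lower bidiagonal factor preserves strictly alternating signs, by forward
substitution. -/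
theorem neg_one_pow_mul_neg_of_lowerProdOp (hα : ∀ i, 1 ≤ i → 0 < α i) {k n : ℕ} {z : ℕ → ℝ}
    (h : ∀ j ≤ n, (-1) ^ j * lowerProdOp p α k z j < 0) : ∀ j ≤ n, (-1) ^ j * z j < 0 := by
  induction k generalizing z with
  | zero => exact h
  | succ k ih =>
    have h1 := ih (z := lowerOp _ z) h
    intro j
    induction j with
    | zero =>
      intro hj
      simpa [lowerOp_apply] using h1 0 hj
    | succ j ihj =>
      intro hj
      have h2 := h1 (j + 1) hj
      have h3 := ihj (by omega)
      rw [lowerOp_apply, if_neg (by omega), Nat.add_sub_cancel, mul_add, pow_succ] at h2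
      have h4 := mul_neg_of_pos_of_neg (hα (k + 1 + 1 + j * (p + 1)) (by omega)) h3
      rw [pow_succ]
      linarith

/-- The zeros of the type II polynomials are nonnegative. -/
theorem nonneg_of_isRoot_typeII (hT : IsMonicBandedHessenberg p T)
    (hα : IsPositiveBidiagonalFactorization p α T) {n : ℕ} {x : ℝ}
    (hx : (typeII T n).IsRoot x) : 0 ≤ x := by
  by_contra! hneg
  obtain ⟨hpos, hfac⟩ := hα
  have key : ∀ n, ∀ j ≤ n, 0 < (-1) ^ j * (typeII T j).eval x := by
    intro n
    induction n with
    | zero =>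
      intro j hj
      obtain rfl : j = 0 := by omega
      simp [typeII]
    | succ n ih =>
      intro j hj
      rcases hj.eq_or_lt with rfl | hlt
      -- For `x < 0` the signs of `x B = L_1 ⋯ L_p (U B)` alternate; stripping the `L_k` gives the
      -- sign of `(U B)_n = U_{n,n} B_n + B_{n+1}`, hence that of `B_{n+1}`.
      · have h1 : ∀ j ≤ n, (-1) ^ j * lowerProdOp p α p
            (truncUpperOp p α 0 fun i => (typeII T i).eval x) j < 0 := by
          intro j hj
          have h2 : lowerProdOp p α p (truncUpperOp p α 0 fun i => (typeII T i).eval x) j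
              = x * (typeII T j).eval x :=
            (truncOp_zero_apply hfac _ j).trans (eval_X_mul_typeII hT x j)
          rw [h2]
          linarith [mul_neg_of_neg_of_pos hneg (ih j hj)]
        have h3 := neg_one_pow_mul_neg_of_lowerProdOp hpos h1 n le_rfl
        rw [truncUpperOp, upperOp_apply, if_neg (by omega)] at h3
        have h4 := mul_pos (hpos (1 + n * (p + 1)) (by omega)) (ih n le_rfl)
        rw [pow_succ]
        linarith
      · exact ih j (by omega)
  have := key n n le_rfl
  rw [hx.eq_zero, mul_zero] at this
  exact lt_irrefl _ this

/-- The zeros of the type II polynomials are bounded by the norm of the matrix. -/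
theorem le_infNorm_of_isRoot_typeII (hT : IsMonicBandedHessenberg p T)
    (hbdd : IsBoundedHessenberg T) {n : ℕ} {x : ℝ} (hx : (typeII T n).IsRoot x) :
    x ≤ infNorm T := by
  have hn : 0 < n := by
    rcases n.eq_zero_or_pos with rfl | h
    · simp [typeII] at hx
    · exact h
  -- Row `i` of the eigenvalue equation at a coordinate of maximal modulus; it reaches at most
  -- column `n`, where `B_n(x) = 0`.
  obtain ⟨i, hi, hmax⟩ := Finset.exists_max_image (Finset.range n)
    (fun j => |(typeII T j).eval x|) ⟨0, Finset.mem_range.2 hn⟩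
  rw [Finset.mem_range] at hi
  have h0 : 1 ≤ |(typeII T i).eval x| := by
    have := hmax 0 (Finset.mem_range.2 hn)
    simpa [typeII] using this
  have h1 : |x| * |(typeII T i).eval x| ≤ absRowSum T i * |(typeII T i).eval x| := by
    rw [← abs_mul, ← eval_X_mul_typeII hT, absRowSum, Finset.sum_mul]
    refine (Finset.abs_sum_le_sum_abs _ _).trans (Finset.sum_le_sum fun j hj => ?_)
    rw [abs_mul]
    refine mul_le_mul_of_nonneg_left ?_ (abs_nonneg _)
    rw [Finset.mem_range] at hj
    rcases (show j ≤ n by omega).eq_or_lt with rfl | hlt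
    · rw [hx.eq_zero, abs_zero]
      exact abs_nonneg _
    · exact hmax j (Finset.mem_range.2 hlt)
  exact (le_abs_self x).trans ((le_of_mul_le_mul_right h1 (by linarith)).trans (le_ciSup hbdd i))

theorem trueInterval_subset_Icc (hT : IsMonicBandedHessenberg p T) (hbdd : IsBoundedHessenberg T)
    (hα : IsPositiveBidiagonalFactorization p α T) :
    trueInterval T ⊆ Set.Icc 0 (infNorm T) :=
  closure_minimal (convexHull_min (fun _ ⟨_, hx⟩ =>
    ⟨nonneg_of_isRoot_typeII hT hα hx, le_infNorm_of_isRoot_typeII hT hbdd hx⟩)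
    (convex_Icc _ _)) isClosed_Icc

theorem isCompact_trueInterval (hT : IsMonicBandedHessenberg p T) (hbdd : IsBoundedHessenberg T)
    (hα : IsPositiveBidiagonalFactorization p α T) : IsCompact (trueInterval T) :=
  isCompact_Icc.of_isClosed_subset isClosed_closure (trueInterval_subset_Icc hT hbdd hα)

theorem mem_trueInterval_of_isRoot {n : ℕ} {x : ℝ} (hx : (typeII T n).IsRoot x) :
    x ∈ trueInterval T :=
  subset_closure (subset_convexHull ℝ _ ⟨n, hx⟩)


/-! ### Limit measures -/

open MeasureTheory Filter Topology

theorem exists_measure_typeII (hT : IsMonicBandedHessenberg p T) (hbdd : IsBoundedHessenberg T)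
    (hα : IsPositiveBidiagonalFactorization p α T) {c : ℕ} (hc : c ≤ p) :
    ∃ μ : Measure ℝ, IsProbabilityMeasure μ ∧ μ (trueInterval T)ᶜ = 0 ∧
      ∀ l, ∫ x, (typeII T l).eval x ∂μ = lowerProdOp p α c (Pi.single 0 1) l := by
  have hcomp : CompactSpace (trueInterval T) :=
    isCompact_iff_compactSpace.1 (isCompact_trueInterval hT hbdd hα)
  have hN : ∀ N : ℕ, ∃ μ : ProbabilityMeasure (trueInterval T), ∀ l ≤ N,
      ∫ x, (typeII T l).eval (x : ℝ) ∂(μ : Measure (trueInterval T))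
        = lowerProdOp p α c (Pi.single 0 1) l := by
    intro N
    obtain ⟨s, w, hs, hw, hsum⟩ := exists_quadrature_typeII hT hα hc N.succ_pos
    let μ : Measure (trueInterval T) := ∑ x ∈ s.attach, ENNReal.ofReal (w x) •
      Measure.dirac ⟨x, mem_trueInterval_of_isRoot (hs x x.2)⟩
    have hμ : IsProbabilityMeasure μ := by
      constructor
      -- The total mass is the integral of `B_0 = 1`, which is the entry 0 of `L_1 ⋯ L_c e_0`.
      have h0 := hsum 0 N.succ_pos
      rw [lowerProdOp_apply_zero, Pi.single_eq_same] at h0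
      simp only [typeII, eval_one, mul_one] at h0
      simp only [μ, Measure.finsetSum_apply, Measure.smul_apply, measure_univ, smul_eq_mul, mul_one]
      rw [Finset.sum_attach s fun x => ENNReal.ofReal (w x), ← ENNReal.ofReal_sum_of_nonneg hw, h0,
        ENNReal.ofReal_one]
    refine ⟨⟨μ, hμ⟩, fun l hl => ?_⟩
    rw [← hsum l (Nat.lt_succ_of_le hl)]
    change ∫ x, (typeII T l).eval (x : ℝ) ∂μ = _
    have hint : ∀ ν : Measure (trueInterval T), IsFiniteMeasure ν →
        Integrable (fun x : trueInterval T => (typeII T l).eval (x : ℝ)) ν := fun ν _ =>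
      ((typeII T l).continuous.comp continuous_subtype_val).integrable_of_hasCompactSupport
        (HasCompactSupport.of_compactSpace _)
    rw [integral_finsetSum_measure fun x _ => (hint _ inferInstance).smul_measure
      ENNReal.ofReal_ne_top, ← Finset.sum_attach s]
    refine Finset.sum_congr rfl fun x _ => ?_
    rw [integral_smul_measure, integral_dirac, ENNReal.toReal_ofReal (hw x x.2), smul_eq_mul]
  choose μs hμs using hN
  -- Probability measures on a compact space form a compact space, so the sequence converges along a
  -- free ultrafilter; each integral of `B_l` is eventually constant.
  obtain ⟨μ, -, hμ⟩ := isCompact_univ.ultrafilter_le_nhds ((hyperfilter ℕ).map μs) (by simp)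
  have hlim : Tendsto μs (hyperfilter ℕ) (𝓝 μ) := hμ
  refine ⟨(μ : Measure (trueInterval T)).map Subtype.val,
    Measure.isProbabilityMeasure_map measurable_subtype_coe.aemeasurable, ?_, fun l => ?_⟩
  · rw [Measure.map_apply measurable_subtype_coe
      (isCompact_trueInterval hT hbdd hα).measurableSet.compl]
    convert measure_empty (μ := (μ : Measure (trueInterval T)))
    ext x
    simp
  · rw [integral_map measurable_subtype_coe.aemeasurable
      (typeII T l).continuous.aestronglyMeasurable]
    have h1 := ProbabilityMeasure.tendsto_iff_forall_integral_tendsto.1 hlim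
      (BoundedContinuousFunction.mkOfCompact
        ⟨fun x : trueInterval T => (typeII T l).eval (x : ℝ), by fun_prop⟩)
    refine tendsto_nhds_unique h1 (tendsto_const_nhds.congr' ?_)
    have h2 : ∀ᶠ N in (hyperfilter ℕ : Filter ℕ), l ≤ N :=
      (eventually_ge_atTop l).filter_mono Nat.hyperfilter_le_atTop
    filter_upwards [h2] with N hN
    exact (hμs N l hN).symm

/-! ### Biorthogonality from the recurrences -/

theorem integrable_eval {μ : Measure ℝ} [IsFiniteMeasureOnCompacts μ] {K : Set ℝ}
    (hK : IsCompact K) (hμ : μ Kᶜ = 0) (P : ℝ[X]) : Integrable (fun x => P.eval x) μ := by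
  have h := P.continuous.continuousOn.integrableOn_compact (μ := μ) hK
  rwa [IntegrableOn, Measure.restrict_eq_self_of_ae_mem (mem_ae_iff.2 hμ)]
    at h

/-- Integration of polynomials against a measure concentrated on a compact set. -/
noncomputable def polynomialIntegral (μ : Measure ℝ) [IsFiniteMeasureOnCompacts μ] {K : Set ℝ}
    (hK : IsCompact K) (hμ : μ Kᶜ = 0) : ℝ[X] →ₗ[ℝ] ℝ where
  toFun P := ∫ x in K, P.eval x ∂μ
  map_add' P Q := by
    simp only [eval_add]
    exact integral_add (integrable_eval hK hμ P).restrict (integrable_eval hK hμ Q).restrict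
  map_smul' c P := by
    simp only [eval_smul, RingHom.id_apply]
    exact integral_smul c _

theorem X_mul_typeII (hT : IsMonicBandedHessenberg p T) (n : ℕ) :
    X * typeII T n = ∑ j ∈ Finset.range (n + 2), T n j • typeII T j := by
  rw [Finset.sum_range_succ, hT.superdiag, one_smul, typeII.eq_2, Finset.sum_range]
  simp [smul_eq_C_mul]

theorem typeI_of_lt (ν : Matrix (Fin p) (Fin p) ℝ) (a : Fin p) {k : ℕ} (hk : k < p) :
    typeI p T ν a k = C (ν ⟨k, hk⟩ a) := by
  rw [typeI, dif_pos hk]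

theorem typeI_add (ν : Matrix (Fin p) (Fin p) ℝ) (a : Fin p) (n : ℕ) :
    typeI p T ν a (n + p) = C (T (n + p) n)⁻¹ * (X * typeI p T ν a n
      - (if n = 0 then 0 else typeI p T ν a (n - 1))
      - ∑ j : Fin p, C (T (n + j) n) * typeI p T ν a (n + j)) := by
  rw [typeI, dif_neg (by omega)]
  simp only [Nat.add_sub_cancel]

/-- Biorthogonality of the type I and type II polynomials follows from its initial cases. -/
theorem biorthogonality_of_initial (hp : 0 < p) (hT : IsMonicBandedHessenberg p T)
    {ν : Matrix (Fin p) (Fin p) ℝ} (φ : Fin p → ℝ[X] →ₗ[ℝ] ℝ)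
    (h0 : ∀ (k : Fin p) (l : ℕ), ∑ a, ν k a * φ a (typeII T l) = if (k : ℕ) = l then 1 else 0)
    (k l : ℕ) : ∑ a, φ a (typeI p T ν a k * typeII T l) = if k = l then 1 else 0 := by
  induction k using Nat.strong_induction_on generalizing l with
  | _ k ih =>
  rcases lt_or_ge k p with hk | hk
  · rw [← h0 ⟨k, hk⟩ l]
    refine Finset.sum_congr rfl fun a _ => ?_
    rw [typeI_of_lt ν a hk, ← smul_eq_C_mul, map_smul, smul_eq_mul]
  · obtain ⟨n, rfl⟩ := Nat.exists_eq_add_of_le' hk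
    -- Multiplication by `X` is moved to the type II side, where it becomes row `l` of `T`; the
    -- known case `n` picks out one entry.
    have hX : ∑ a, φ a (typeI p T ν a n * (X * typeII T l)) = T l n := by
      have h1 : ∀ a, φ a (typeI p T ν a n * (X * typeII T l))
          = ∑ j ∈ Finset.range (l + 2), T l j * φ a (typeI p T ν a n * typeII T j) := by
        intro a
        rw [X_mul_typeII hT, Finset.mul_sum, map_sum]
        refine Finset.sum_congr rfl fun j _ => ?_
        rw [mul_smul_comm, map_smul, smul_eq_mul]
      simp only [h1]
      rw [Finset.sum_comm]
      simp only [← Finset.mul_sum]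
      rw [Finset.sum_congr rfl fun j _ => by rw [ih n (by omega)]]
      simp only [mul_ite, mul_one, mul_zero, Finset.sum_ite_eq, Finset.mem_range]
      split_ifs with h
      · rfl
      · exact (hT.above l n (by omega)).symm
    have hprev : ∑ a, φ a ((if n = 0 then 0 else typeI p T ν a (n - 1)) * typeII T l)
        = if l + 1 = n then 1 else 0 := by
      rcases n with _ | n
      · simp
      · simp only [Nat.add_eq_zero_iff, one_ne_zero, and_false, if_false, Nat.add_sub_cancel]
        rw [ih n (by omega)]
        simp [eq_comm]
    have hsum : ∑ a, φ a ((∑ j : Fin p, C (T (n + j) n) * typeI p T ν a (n + j)) * typeII T l)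
        = if n ≤ l ∧ l < n + p then T l n else 0 := by
      have h1 : ∀ a, φ a ((∑ j : Fin p, C (T (n + j) n) * typeI p T ν a (n + j)) * typeII T l)
          = ∑ j : Fin p, T (n + j) n * φ a (typeI p T ν a (n + j) * typeII T l) := by
        intro a
        rw [Finset.sum_mul, map_sum]
        refine Finset.sum_congr rfl fun j _ => ?_
        rw [mul_assoc, ← smul_eq_C_mul, map_smul, smul_eq_mul]
      simp only [h1]
      rw [Finset.sum_comm]
      simp only [← Finset.mul_sum]
      rw [Finset.sum_congr rfl fun (j : Fin p) _ => by rw [ih (n + j) (by omega)]]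
      split_ifs with h
      · rw [Finset.sum_eq_single ⟨l - n, by omega⟩]
        · have e : n + (l - n) = l := by omega
          simp [e]
        · intro j _ hj
          rw [if_neg, mul_zero]
          intro hl
          exact hj (Fin.ext (by simp only; omega))
        · simp
      · refine Finset.sum_eq_zero fun j _ => ?_
        rw [if_neg (by omega), mul_zero]
    have h2 : ∀ a, φ a (typeI p T ν a (n + p) * typeII T l) = (T (n + p) n)⁻¹ *
        (φ a (typeI p T ν a n * (X * typeII T l))
          - φ a ((if n = 0 then 0 else typeI p T ν a (n - 1)) * typeII T l)
          - φ a ((∑ j : Fin p, C (T (n + j) n) * typeI p T ν a (n + j)) * typeII T l)) := by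
      intro a
      rw [typeI_add, ← map_sub, ← map_sub, ← smul_eq_mul (a := (T (n + p) n)⁻¹), ← map_smul,
        smul_eq_C_mul]
      congr 1
      ring
    simp only [h2]
    rw [← Finset.mul_sum, Finset.sum_sub_distrib, Finset.sum_sub_distrib, hX, hprev, hsum,
      inv_mul_eq_iff_eq_mul₀ (hT.lowest n)]
    -- Column `n` of `T` loses its superdiagonal entry and all band entries above row `n + p`, so
    -- only `T_{n+p,n}` at `l = n + p` survives.
    rcases lt_trichotomy l (n + p) with h | rfl | h
    · rw [if_neg (by omega : ¬ n + p = l)]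
      rcases lt_trichotomy (l + 1) n with h' | rfl | h'
      · rw [hT.above l n h', if_neg (by omega), if_neg (by omega)]
        simp
      · rw [hT.superdiag, if_pos rfl, if_neg (by omega)]
        simp
      · rw [if_neg (by omega), if_pos (by omega)]
        simp
    · rw [if_neg (by omega), if_neg (by omega)]
      simp
    · rw [hT.below l n h, if_neg (by omega), if_neg (by omega), if_neg (by omega)]
      simp

/-! ### Initial conditions and assembly -/

/-- Truncation commutes with products of lower triangular matrices, since the first `p` entries
depend only on the first `p` entries. -/
theorem lowerFactorTrunc_prod_mulVec (c : ℕ) (v : ℕ → ℝ) (i : Fin p) :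
    ((List.range c).map fun m => lowerFactorTrunc p α (m + 1)).prod.mulVec (fun j => v j) i
      = lowerProdOp p α c v i := by
  induction c generalizing v with
  | zero => simp [lowerProdOp]
  | succ c ih =>
    rw [List.range_succ, List.map_append, List.prod_append, List.map_singleton,
      List.prod_singleton, ← Matrix.mulVec_mulVec, lowerProdOp, Module.End.mul_apply, ← ih]
    congr 1
    ext ⟨j, hj⟩
    rw [lowerOp_apply, Matrix.mulVec, dotProduct]
    rcases j with _ | j
    · rw [Finset.sum_eq_single ⟨0, hj⟩]
      · simp [lowerFactorTrunc, lowerFactor]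
      · intro m _ hm
        have : ¬ 0 = (m : ℕ) := fun h => hm (Fin.ext h.symm)
        simp [lowerFactorTrunc, lowerFactor, this]
      · simp
    · rw [Finset.sum_eq_add (⟨j + 1, hj⟩ : Fin p) ⟨j, by omega⟩ (by simp)]
      · simp [lowerFactorTrunc, lowerFactor]
      · rintro m _ ⟨h1, h2⟩
        have e1 : ¬ j + 1 = (m : ℕ) := fun h => h1 (Fin.ext h.symm)
        have e2 : ¬ j = (m : ℕ) := fun h => h2 (Fin.ext h.symm)
        simp [lowerFactorTrunc, lowerFactor, e1, e2]
      · simp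
      · simp

theorem scriptL_apply (i c : Fin p) :
    scriptL p α i c = (∏ m ∈ Finset.range (c : ℕ), α ((c : ℕ) + 1 + m * p))⁻¹ *
      lowerProdOp p α c (Pi.single 0 1) i := by
  rw [scriptL, Matrix.of_apply, ← lowerFactorTrunc_prod_mulVec]
  simp only [Pi.single_apply]

theorem IsLowerUnitriangular.det_eq_one {ν : Matrix (Fin p) (Fin p) ℝ}
    (hν : IsLowerUnitriangular ν) : ν.det = 1 := by
  rw [Matrix.det_of_isLowerTriangular ν fun i j hij => hν.2 i j hij]
  exact Finset.prod_eq_one fun i _ => hν.1 i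

theorem stieltjesFunction_measure_sum {ι : Type*} (s : Finset ι) (c : ι → NNReal)
    (f : ι → StieltjesFunction ℝ) :
    (∑ i ∈ s, c i • f i).measure = ∑ i ∈ s, c i • (f i).measure := by
  classical
  induction s using Finset.induction_on with
  | empty => simp [StieltjesFunction.measure_zero]
  | insert i s hi ih =>
    rw [Finset.sum_insert hi, Finset.sum_insert hi, StieltjesFunction.measure_add,
      StieltjesFunction.measure_smul, ih]

end HessenbergFavard

theorem mainTheorem1 (p : ℕ) (hp : 1 ≤ p)
    (T : Matrix ℕ ℕ ℝ) (hT : IsMonicBandedHessenberg p T) (hbdd : IsBoundedHessenberg T)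
    (α : ℕ → ℝ) (hα : IsPositiveBidiagonalFactorization p α T)
    (ν Cm : Matrix (Fin p) (Fin p) ℝ) (hν : IsLowerUnitriangular ν)
    (hCm : IsUpperUnitriangular Cm) (hCm_nonneg : ∀ i j, 0 ≤ Cm i j)
    (hνC : (ν⁻¹).transpose = scriptL p α * Cm) :
    IsCompact (trueInterval T) ∧ trueInterval T ⊆ Set.Icc 0 (infNorm T) ∧
      ∃ ψ : Fin p → StieltjesFunction ℝ,
        (∀ a, (ψ a).measure (trueInterval T)ᶜ = 0) ∧
        ∀ k l : ℕ,
          ∑ a, ∫ x in trueInterval T,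
              (typeI p T ν a k).eval x * (typeII T l).eval x ∂(ψ a).measure
            = if k = l then 1 else 0 := by
  have hΔ := isCompact_trueInterval hT hbdd hα
  refine ⟨hΔ, trueInterval_subset_Icc hT hbdd hα, ?_⟩
  choose μ hμprob hμ0 hμint using fun c : Fin p => exists_measure_typeII hT hbdd hα c.2.le
  -- Numbering from zero: `d c` is `1 / d_{c+1}`, with an empty product for `c = 0`.
  let d : Fin p → ℝ := fun c => (∏ m ∈ Finset.range (c : ℕ), α ((c : ℕ) + 1 + m * p))⁻¹
  have hd : ∀ c, 0 ≤ d c := fun c =>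
    inv_nonneg.2 (Finset.prod_nonneg fun m _ => (hα.1 _ (by omega)).le)
  let w : Fin p → Fin p → NNReal := fun c a => ⟨Cm c a * d c, mul_nonneg (hCm_nonneg c a) (hd c)⟩
  let ψ : Fin p → StieltjesFunction ℝ := fun a => ∑ c, w c a • ProbabilityTheory.cdf (μ c)
  have hψ : ∀ a, (ψ a).measure = ∑ c, w c a • μ c := by
    intro a
    rw [stieltjesFunction_measure_sum]
    exact Finset.sum_congr rfl fun c _ => by rw [ProbabilityTheory.measure_cdf]
  have hψ0 : ∀ a, (ψ a).measure (trueInterval T)ᶜ = 0 := by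
    intro a
    rw [hψ, MeasureTheory.Measure.finsetSum_apply]
    exact Finset.sum_eq_zero fun c _ => by rw [MeasureTheory.Measure.smul_apply, hμ0, smul_zero]
  refine ⟨ψ, hψ0, fun k l => ?_⟩
  have hB : ∀ a l, polynomialIntegral (ψ a).measure hΔ (hψ0 a) (typeII T l)
      = ∑ c, Cm c a * (d c * lowerProdOp p α c (Pi.single 0 1) l) := by
    intro a l
    change ∫ x in trueInterval T, (typeII T l).eval x ∂(ψ a).measure = _
    have hmem : ∀ᵐ x ∂(ψ a).measure, x ∈ trueInterval T := MeasureTheory.mem_ae_iff.2 (hψ0 a)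
    rw [MeasureTheory.Measure.restrict_eq_self_of_ae_mem hmem, hψ,
      MeasureTheory.integral_finsetSum_measure fun c _ =>
        (integrable_eval hΔ (hμ0 c) (typeII T l)).smul_measure_nnreal]
    refine Finset.sum_congr rfl fun c _ => ?_
    rw [MeasureTheory.integral_smul_nnreal_measure, hμint, ← mul_assoc]
    rfl
  have hbi := biorthogonality_of_initial hp hT (ν := ν)
    (fun a => polynomialIntegral (ψ a).measure hΔ (hψ0 a)) (fun k l => ?_) k l
  · rw [← hbi]
    refine Finset.sum_congr rfl fun a _ => ?_
    change _ = ∫ x in trueInterval T, (typeI p T ν a k * typeII T l).eval x ∂(ψ a).measure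
    simp only [Polynomial.eval_mul]
  · simp only [hB]
    rcases lt_or_ge l p with hl | hl
    · have h1 : ∀ a, ∑ c, Cm c a * (d c * lowerProdOp p α c (Pi.single 0 1) l)
          = (ν⁻¹) a ⟨l, hl⟩ := by
        intro a
        rw [← Matrix.transpose_apply ν⁻¹, hνC, Matrix.mul_apply]
        refine Finset.sum_congr rfl fun c _ => ?_
        rw [scriptL_apply, mul_comm]
      simp only [h1]
      rw [← Matrix.mul_apply, Matrix.mul_nonsing_inv _ (by rw [hν.det_eq_one]; exact isUnit_one),
        Matrix.one_apply]
      simp [Fin.ext_iff]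
    · rw [if_neg (by omega)]
      refine Finset.sum_eq_zero fun a _ => ?_
      rw [Finset.sum_eq_zero, mul_zero]
      intro c _
      -- `L_1 ⋯ L_c e_0` is supported in rows `0, …, c`, and `c < p ≤ l`.
      rw [lowerProdOp_single_zero_eq_zero (by omega), mul_zero, mul_zero]
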